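/- Let $n,\delta\ge 0$ be integers and let $H_n=\mathbb F_2^n$ with Hamming distance $d$ and weight $wt$; identify words with their supports. For $0\le k\le\lfloor n/2\rfloor$ let $X_k$ be the set of words of weight $k$, let $H_{k,k}$ be the space of real functions $f$ on $X_k$ with $\sum_{x\in X_k,\ z\subset x}f(x)=0$ for all $z$ of weight $k-1$, let $(e_{k,k,s})_s$ be an orthonormal basis of it for $\langle f,g\rangle=2^{-n}\sum_x f(x)g(x)$, and for $k\le i\le n-k$ put $e_{k,i,s}(y)=\sum_{x\in X_k,\ x\subset y}e_{k,k,s}(x)$ if $wt(y)=i$ and $e_{k,i,s}(y)=0$ otherwise. The zonal matrices are $$E_k(x,y)=\Big(\sum_s e_{k,i,s}(x)e_{k,j,s}(y)\Big)_{k\le i,j\le n-k},\qquad F_k(x,y,z)=E_k(x-z,y-z).$$ Let $$\Omega=\{(a,b,c)\in\{0,\dots,n\}^3:\ a+b+c \text{ even},\ a+b+c\le 2n,\ a\le b+c,\ b\le a+c,\ c\le a+b\},$$ let $t(a,b,c)=\binom{c}{i}\binom{n-c}{a-i}$ with $2i=a-b+c$, and let $K_k(w)=\sum_i(-1)^i\binom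 wi\binom{n-w}{k-i}$ be the Krawtchouk polynomials. Then $\Omega=\{(d(y,z),d(x,z),d(x,y)):x,y,z\in H_n\}$; the matrix $F_k(x,y,z)$ depends only on $(a,b,c)=(d(y,z),d(x,z),d(x,y))$, so that $F_k(x,y,z)=T_k(a,b,c)$ for some matrices $T_k(a,b,c)$; and for $(a,b,c)\in\Omega$ and $d(x,y)=c$, $t(a,b,c)$ is the number of $z\in H_n$ with $d(x,z)=b$ and $d(y,z)=a$. For real variables $x_{a,b,c}$, $(a,b,c)\in\Omega$, consider the constraints 1. $x_{0,0,0}=1$; 2. $x_{a,b,c}\ge0$; 3. $x_{a,b,c}$ is invariant under all permutations of its three indices; 4. $x_{a,b,c}\le t(a,b,c)x_{0,c,c}$, $x_{a,b,c}\le t(b,c,a)x_{0,a,a}$, $x_{a,b,c}\le t(c,a,b)x_{0,b,b}$; 5. $\sum_{(a,b,c)\in\Omega}T_k(a,b,c)\,x_{a,b,c}\succeq0$ for all $0\le k\le\lfloor n/2\rfloor$; 6. $\sum_{(a,b,c)\in\Omega}T_k(a,b,c)\,\big(t(a,b,c)x_{0,c,c}-x_{a,b,c}\big)\succeq0$ for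 all $0\le k\le\lfloor n/2\rfloor$; 7. $x_{a,b,c}=0$ if $a$, $b$ or $c$ lies in $]0,\delta[$. (i) If $C\subset H_n$ is a non-empty code whose distinct words are at distance at least $\delta$, then $$x_{a,b,c}=\frac1{|C|}\,\big|\{(x,y,z)\in C^3:\ d(y,z)=a,\ d(x,z)=b,\ d(x,y)=c\}\big|$$ satisfies (1)–(7), and $|C|=\sum_{c=0}^n x_{0,c,c}$. For these variables, for any non-empty code $C$, the matrices in (5) and (6) multiplied by $|C|$ are $\sum_{(x,y,z)\in C^3}F_k(x,y,z)$ and $\sum_{(x,y)\in C^2,\ z\notin C}F_k(x,y,z)$. Consequently every code with minimal distance at least $\delta$ has at most $\mathrm{SDP}(n,\delta)$ words, where $\mathrm{SDP}(n,\delta)$ is the supremum of $\sum_{c}x_{0,c,c}$ under (1)–(7). (ii) For all reals $x_{a,b,c}$, the sum of the matrices in (5) and (6) is $\sum_{(a,b,c)\in\Omega}t(a,b,c)\,x_{0,c,c}\,T_k(a,b,c)$, where $\sum_{(a,b):\,(a,b,c)\in\Omega}t(a,b,c)T_k(a,b,c)=\sum_{z\in H_n}E_k(x-z,y-z)$ whenever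 $d(x,y)=c$. This sum is positive semidefinite for all $0\le k\le\lfloor n/2\rfloor$ if and only if $\sum_{c=0}^n x_{0,c,c}K_k(c)\ge0$ for all $0\le k\le n$. (iii) Consequently, if $(x_{a,b,c})$ satisfies (1)–(7), then $x_c:=x_{0,c,c}$ $(0\le c\le n)$ is feasible for the Delsarte linear program $$\sup\Big\{\sum_{i=0}^n x_i:\ x_0=1,\ x_i\ge0,\ \sum_{i=0}^n x_iK_k(i)\ge0\ (0\le k\le n),\ x_i=0\ (1\le i\le\delta-1)\Big\},$$ with the same objective value, so $\mathrm{SDP}(n,\delta)$ is at most the value of this linear program. -/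

import Mathlib

open scoped BigOperators

noncomputable section

namespace BinaryCode

/-- The binary Hamming space `H_n = 𝔽₂ⁿ`; distance and weight are `hammingDist` and `hammingNorm`. -/
abbrev Hn (n : ℕ) : Type := Fin n → ZMod 2

/-- Inclusion of the supports, i.e. `x ⊆ y` when binary words are viewed as subsets. -/
def Sub {n : ℕ} (x y : Hn n) : Prop := ∀ i, x i ≠ 0 → y i ≠ 0

instance {n : ℕ} (x y : Hn n) : Decidable (Sub x y) := by
  unfold Sub; infer_instance

/-- The space `H_{k,k}`, the kernel of
`δ_k : 𝒞(X_k) → 𝒞(X_{k-1})`, `δ_k f (z) = ∑_{|x| = k, z ⊆ x} f x`, where `X_k` is the set of words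
of weight `k` and a function on `X_k` is extended by zero to `H_n`. -/
def harm (n k : ℕ) : Submodule ℝ (EuclideanSpace ℝ (Hn n)) where
  carrier := {f | (∀ x : Hn n, hammingNorm x ≠ k → f x = 0) ∧
    ∀ z : Hn n, hammingNorm z + 1 = k →
      ∑ x : Hn n with hammingNorm x = k ∧ Sub z x, f x = 0}
  zero_mem' := by simp
  add_mem' := by
    rintro f g ⟨hf, hf'⟩ ⟨hg, hg'⟩
    refine ⟨fun x hx => by simp [hf x hx, hg x hx], fun z hz => ?_⟩
    simp [Finset.sum_add_distrib, hf' z hz, hg' z hz]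
  smul_mem' := by
    rintro c f ⟨hf, hf'⟩
    refine ⟨fun x hx => by simp [hf x hx], fun z hz => ?_⟩
    simp [← Finset.mul_sum, hf' z hz]

/-- `h_k = dim H_{k,k}`. -/
abbrev harmDim (n k : ℕ) : ℕ := Module.finrank ℝ (harm n k)

/-- An orthonormal basis `e_{k,k,s}` of `H_{k,k}` for `⟨f, g⟩ = 2⁻ⁿ ∑_x f x * g x`.
The factor `√(2ⁿ)` passes from the unnormalized to this normalized inner product. -/
def basisVec (n k : ℕ) (s : Fin (harmDim n k)) (x : Hn n) : ℝ :=
  Real.sqrt (2 ^ n) * (stdOrthonormalBasis ℝ (harm n k) s : EuclideanSpace ℝ (Hn n)) x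

/-- `e_{k,i,s} = ψ_{k,i} (e_{k,k,s})`, where `ψ_{k,i} f (y) = ∑_{|x| = k, x ⊆ y} f x` for
`|y| = i`, extended by zero to `H_n`. -/
def isoVec (n k i : ℕ) (s : Fin (harmDim n k)) (y : Hn n) : ℝ :=
  if hammingNorm y = i then ∑ x : Hn n with hammingNorm x = k ∧ Sub x y, basisVec n k s x else 0

/-- The zonal matrix `E_k(x, y)`, of size `n - 2k + 1`, with coefficients
`E_{k,i,j}(x, y) = ∑_s e_{k,i,s}(x) e_{k,j,s}(y)` for `k ≤ i, j ≤ n - k`; rows and columns are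
numbered from `0`, so the row `i` here is the row `k + i`.
It does not depend on the choice of the orthonormal basis. -/
def zonalE (n k : ℕ) (x y : Hn n) : Matrix (Fin (n - 2 * k + 1)) (Fin (n - 2 * k + 1)) ℝ :=
  Matrix.of fun i j => ∑ s, isoVec n k (k + i) s x * isoVec n k (k + j) s y

/-- `F_k(x, y, z) = E_k(x - z, y - z)`. -/
def zonalF (n k : ℕ) (x y z : Hn n) : Matrix (Fin (n - 2 * k + 1)) (Fin (n - 2 * k + 1)) ℝ :=
  zonalE n k (x - z) (y - z)

/-- `(d(y,z), d(x,z), d(x,y)) = (a, b, c)`. -/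
def HasDists {n : ℕ} (a b c : ℕ) (x y z : Hn n) : Prop :=
  hammingDist y z = a ∧ hammingDist x z = b ∧ hammingDist x y = c

instance {n : ℕ} (a b c : ℕ) (x y z : Hn n) : Decidable (HasDists a b c x y z) := by
  unfold HasDists; infer_instance

open Classical in
/-- `T_k(a, b, c)`: the value of `F_k` on the triples `(x, y, z)` with
`(d(y,z), d(x,z), d(x,y)) = (a, b, c)` (and `0` if there is no such triple). -/
def matT (n k a b c : ℕ) : Matrix (Fin (n - 2 * k + 1)) (Fin (n - 2 * k + 1)) ℝ :=
  if h : ∃ p : Hn n × Hn n × Hn n, HasDists a b c p.1 p.2.1 p.2.2 then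
    zonalF n k h.choose.1 h.choose.2.1 h.choose.2.2
  else 0

/-- The index set `Ω`. -/
def Omega (n : ℕ) : Finset (ℕ × ℕ × ℕ) :=
  (Finset.range (n + 1) ×ˢ Finset.range (n + 1) ×ˢ Finset.range (n + 1)).filter fun p =>
    2 ∣ p.1 + p.2.1 + p.2.2 ∧ p.1 + p.2.1 + p.2.2 ≤ 2 * n ∧
    p.2.2 ≤ p.1 + p.2.1 ∧ p.2.1 ≤ p.1 + p.2.2 ∧ p.1 ≤ p.2.1 + p.2.2

/-- `t(a, b, c) = binom(c, i) binom(n - c, a - i)` with `2 i = a - b + c`; used on `Ω` only. -/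
def tCount (n a b c : ℕ) : ℕ :=
  c.choose ((a + c - b) / 2) * (n - c).choose (a - (a + c - b) / 2)

/-- The three-point distribution `x_{a,b,c}` of a code. -/
def tripleDist {n : ℕ} (C : Finset (Hn n)) (a b c : ℕ) : ℝ :=
  (((C ×ˢ C ×ˢ C).filter fun p => HasDists a b c p.1 p.2.1 p.2.2).card : ℝ) / (C.card : ℝ)

/-- Any two distinct words of `C` are at distance at least `δ`. -/
def MinDistGE {n : ℕ} (δ : ℕ) (C : Finset (Hn n)) : Prop :=
  ∀ c ∈ C, ∀ c' ∈ C, c ≠ c' → δ ≤ hammingDist c c'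

/-- The left-hand side `∑ T_k(a,b,c) x_{a,b,c}` of the first semidefinite condition. -/
def sdpMatrix₁ (n k : ℕ) (x : ℕ → ℕ → ℕ → ℝ) :
    Matrix (Fin (n - 2 * k + 1)) (Fin (n - 2 * k + 1)) ℝ :=
  ∑ p ∈ Omega n, x p.1 p.2.1 p.2.2 • matT n k p.1 p.2.1 p.2.2

/-- The left-hand side `∑ T_k(a,b,c) (t(a,b,c) x_{0,c,c} - x_{a,b,c})` of the second
semidefinite condition. -/
def sdpMatrix₂ (n k : ℕ) (x : ℕ → ℕ → ℕ → ℝ) :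
    Matrix (Fin (n - 2 * k + 1)) (Fin (n - 2 * k + 1)) ℝ :=
  ∑ p ∈ Omega n, ((tCount n p.1 p.2.1 p.2.2 : ℝ) * x 0 p.2.2 p.2.2 - x p.1 p.2.1 p.2.2) •
    matT n k p.1 p.2.1 p.2.2

/-- The objective `∑_c x_{0,c,c}`. -/
def sdpObjective (n : ℕ) (x : ℕ → ℕ → ℕ → ℝ) : ℝ := ∑ c ∈ Finset.range (n + 1), x 0 c c

/-- The constraints (1)-(7) on the variables `x_{a,b,c}`, `(a,b,c) ∈ Ω`
(values of `x` outside `Ω` play no role). -/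
structure SDPFeasible (n δ : ℕ) (x : ℕ → ℕ → ℕ → ℝ) : Prop where
  c1 : x 0 0 0 = 1
  c2 : ∀ a b c, (a, b, c) ∈ Omega n → 0 ≤ x a b c
  c3 : ∀ a b c, (a, b, c) ∈ Omega n →
    x a b c = x a c b ∧ x a b c = x b a c ∧ x a b c = x b c a ∧
    x a b c = x c a b ∧ x a b c = x c b a
  c4 : ∀ a b c, (a, b, c) ∈ Omega n →
    x a b c ≤ tCount n a b c * x 0 c c ∧
    x a b c ≤ tCount n b c a * x 0 a a ∧
    x a b c ≤ tCount n c a b * x 0 b b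
  c5 : ∀ k, k ≤ n / 2 → (sdpMatrix₁ n k x).PosSemidef
  c6 : ∀ k, k ≤ n / 2 → (sdpMatrix₂ n k x).PosSemidef
  c7 : ∀ a b c, (a, b, c) ∈ Omega n →
    (0 < a ∧ a < δ) ∨ (0 < b ∧ b < δ) ∨ (0 < c ∧ c < δ) → x a b c = 0

/-- The semidefinite programming bound: the supremum of the objective under (1)-(7). -/
def sdpBound (n δ : ℕ) : EReal :=
  sSup {v : EReal | ∃ x, SDPFeasible n δ x ∧ v = ((sdpObjective n x : ℝ) : EReal)}

/-- The Krawtchouk polynomial `K_k(w) = ∑_i (-1)^i binom(w, i) binom(n - w, k - i)`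
at `0 ≤ w ≤ n`. -/
def krawtchouk (n k w : ℕ) : ℝ :=
  ∑ i ∈ Finset.range (k + 1), (-1 : ℝ) ^ i * (w.choose i : ℝ) * ((n - w).choose (k - i) : ℝ)

/-- The constraints of the Delsarte linear program on `x_0, …, x_n`. -/
structure LPFeasible (n δ : ℕ) (x : ℕ → ℝ) : Prop where
  l1 : x 0 = 1
  l2 : ∀ i, i ≤ n → 0 ≤ x i
  l3 : ∀ k, k ≤ n → 0 ≤ ∑ i ∈ Finset.range (n + 1), x i * krawtchouk n k i
  l4 : ∀ i, i ≤ n → 1 ≤ i → i < δ → x i = 0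

/-- The Delsarte linear programming bound. -/
def lpBound (n δ : ℕ) : EReal :=
  sSup {v : EReal | ∃ x, LPFeasible n δ x ∧
    v = ((∑ i ∈ Finset.range (n + 1), x i : ℝ) : EReal)}

end BinaryCode

end

open scoped BigOperators

/-! The matrix `E_k(x, y)` is built from the reproducing kernel of the harmonic space, which depends
on the space alone and is therefore invariant under coordinate permutations (`harmKernel_permWord`).
Two pairs of words with equal weights and equal distance are conjugate (`exists_perm`), so `F_k` is
a function of the three distances.

For a code, fix `z`: the sum of `F_k(x, y, z)` over `x, y ∈ C` is a sum of matrices `v vᵀ`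
(`posSemidef_sum_zonalF`). Letting `z` run over `C` gives condition (5), and over the complement
condition (6). The latter is the sum over all `z` minus the sum over `C`, and `t(a, b, c)` counts
all `z` (`card_dists`).

The sum of (5) and (6) is `∑_c x_{0,c,c} P_c`, where `P_c = ∑_z E_k(u + z, z)` for any `u` of weight
`c`. This is an autocorrelation, so the Fourier transform of `𝔽₂ⁿ` turns it into a combination of
positive semidefinite matrices `M_w`; averaging over the sphere of radius `c` gives `M_w` in `2ⁿ
P_c` the coefficient `K_m(c) / binom(n, m)` with `m = wt(w)` (`two_pow_smul_pairMatrix'`). Hence the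
Krawtchouk inequalities imply semidefiniteness for every `k`. Conversely `k = 0` suffices: on the
test vector `(K_m(i))_i` the quadratic form of `P_c` is `4ⁿ K_m(c)`
(`krawtchouk_quadratic_pairMatrix`). -/

namespace BinaryCode

/-! ### Words as sets, and counting by intersections -/

/-- The support of a binary word. -/
def supp {n : ℕ} (x : Hn n) : Finset (Fin n) := Finset.univ.filter fun i => x i ≠ 0

lemma mem_supp {n : ℕ} {x : Hn n} {i : Fin n} : i ∈ supp x ↔ x i ≠ 0 := by simp [supp]

lemma card_supp {n : ℕ} (x : Hn n) : (supp x).card = hammingNorm x := rfl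

/-- Binary words correspond to their supports. -/
def wordEquiv (n : ℕ) : Hn n ≃ Finset (Fin n) where
  toFun := supp
  invFun S i := if i ∈ S then 1 else 0
  left_inv x := by
    funext i
    simp only [mem_supp]
    generalize x i = a
    revert a; decide
  right_inv S := by
    ext i
    by_cases h : i ∈ S <;> simp [mem_supp, h]

lemma zmod_two_sub_ne_zero : ∀ a b : ZMod 2, a - b ≠ 0 ↔ (a ≠ 0 ∧ b = 0) ∨ (b ≠ 0 ∧ a = 0) := by
  decide

lemma supp_sub {n : ℕ} (x y : Hn n) :
    supp (x - y) = (supp x \ supp y) ∪ (supp y \ supp x) := by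
  ext i
  simp only [mem_supp, Finset.mem_union, Finset.mem_sdiff, Pi.sub_apply, not_not]
  exact zmod_two_sub_ne_zero _ _

lemma hammingNorm_sub_add {n : ℕ} (x y : Hn n) :
    hammingNorm (x - y) + 2 * (supp x ∩ supp y).card = hammingNorm x + hammingNorm y := by
  rw [← card_supp, ← card_supp, ← card_supp, supp_sub, Finset.card_union_of_disjoint]
  · have h1 := Finset.card_sdiff_add_card_inter (supp x) (supp y)
    have h2 := Finset.card_sdiff_add_card_inter (supp y) (supp x)
    rw [Finset.inter_comm (supp y)] at h2
    omega
  · exact disjoint_sdiff_sdiff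

lemma card_supp_union_le {n : ℕ} (x y : Hn n) :
    hammingNorm x + hammingNorm y ≤ n + (supp x ∩ supp y).card := by
  have h := Finset.card_union_add_card_inter (supp x) (supp y)
  have h' := (supp x ∪ supp y).card_le_univ
  rw [Fintype.card_fin] at h'
  rw [← card_supp, ← card_supp]
  omega

lemma hammingNorm_le_dim {n : ℕ} (x : Hn n) : hammingNorm x ≤ n := by
  simpa using hammingNorm_le_card_fintype (x := x)

lemma exists_hammingNorm_eq {n c : ℕ} (hc : c ≤ n) : ∃ u : Hn n, hammingNorm u = c := by
  obtain ⟨S, -, hS⟩ := Finset.exists_subset_card_eq (s := (Finset.univ : Finset (Fin n)))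
    (n := c) (by simpa using hc)
  refine ⟨(wordEquiv n).symm S, ?_⟩
  rw [← card_supp, ← hS]
  exact congrArg _ ((wordEquiv n).apply_symm_apply S)

/-- The number of sets meeting `U` and its complement in prescribed numbers of points. -/
lemma card_finset_inter_sdiff {n : ℕ} (U : Finset (Fin n)) (i j : ℕ) :
    (Finset.univ.filter fun W : Finset (Fin n) => (W ∩ U).card = i ∧ (W \ U).card = j).card =
      U.card.choose i * (n - U.card).choose j := by
  have hU : (Uᶜ).card = n - U.card := by rw [Finset.card_compl, Fintype.card_fin]
  rw [← hU, ← Finset.card_powersetCard, ← Finset.card_powersetCard, ← Finset.card_product]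
  refine Finset.card_nbij' (fun W => (W ∩ U, W \ U)) (fun p => p.1 ∪ p.2) ?_ ?_ ?_ ?_
  · intro W hW
    simp only [Finset.coe_filter, Finset.mem_univ, true_and, Set.mem_ofPred_eq] at hW
    simp only [Finset.coe_product, Set.mem_prod, Finset.mem_coe, Finset.mem_powersetCard]
    refine ⟨⟨Finset.inter_subset_right, hW.1⟩, ⟨fun a ha => ?_, hW.2⟩⟩
    simpa using (Finset.mem_sdiff.1 ha).2
  · rintro ⟨A, B⟩ h
    simp only [Finset.coe_product, Set.mem_prod, Finset.mem_coe, Finset.mem_powersetCard] at h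
    obtain ⟨⟨hA, rfl⟩, hB, rfl⟩ := h
    have hB' : ∀ a ∈ B, a ∉ U := fun a ha => by simpa using hB ha
    simp only [Finset.coe_filter, Finset.mem_univ, true_and, Set.mem_ofPred_eq]
    constructor
    · congr 1; ext a
      have := @hA a
      have := hB' a
      simp only [Finset.mem_inter, Finset.mem_union]; tauto
    · congr 1; ext a
      have := @hA a
      have := hB' a
      simp only [Finset.mem_sdiff, Finset.mem_union]; tauto
  · intro W _
    ext a
    simp only [Finset.mem_union, Finset.mem_inter, Finset.mem_sdiff]; tauto
  · rintro ⟨A, B⟩ h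
    simp only [Finset.coe_product, Set.mem_prod, Finset.mem_coe, Finset.mem_powersetCard] at h
    obtain ⟨⟨hA, -⟩, hB, -⟩ := h
    have hB' : ∀ a ∈ B, a ∉ U := fun a ha => by simpa using hB ha
    refine Prod.ext ?_ ?_ <;>
    · ext a
      have := @hA a
      have := hB' a
      simp only [Finset.mem_sdiff, Finset.mem_inter, Finset.mem_union]; tauto

lemma card_word_inter_sdiff {n : ℕ} (U : Finset (Fin n)) (i j : ℕ) :
    (Finset.univ.filter fun w : Hn n => (supp w ∩ U).card = i ∧ (supp w \ U).card = j).card =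
      U.card.choose i * (n - U.card).choose j := by
  rw [← card_finset_inter_sdiff]
  refine Finset.card_equiv (wordEquiv n) fun w => ?_
  simp [wordEquiv]

/-! ### The index set `Ω` and the numbers `t(a, b, c)` -/

lemma mem_Omega {n a b c : ℕ} : (a, b, c) ∈ Omega n ↔
    2 ∣ a + b + c ∧ a + b + c ≤ 2 * n ∧ c ≤ a + b ∧ b ≤ a + c ∧ a ≤ b + c := by
  simp only [Omega, Finset.mem_filter, Finset.mem_product, Finset.mem_range]
  constructor
  · exact fun h => h.2
  · intro h
    exact ⟨⟨by omega, by omega, by omega⟩, h⟩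

lemma dist_eq_norm_sub {n : ℕ} (x y : Hn n) : hammingDist x y = hammingNorm (x - y) := by
  simp only [hammingDist, hammingNorm, Pi.sub_apply, sub_ne_zero]

lemma hammingDist_eq_norm_sub {n : ℕ} (x y z : Hn n) :
    hammingDist x y = hammingNorm ((x - z) - (y - z)) := by
  rw [dist_eq_norm_sub, sub_sub_sub_cancel_right]

/-- Put `U = supp (x - y)` and `W = supp (y - z)`. The conditions say that `W` has `a` points and
its symmetric difference with `U` has `b`, so `W` has `(a + c - b) / 2` points in `U` and the rest
outside. -/
lemma card_dists {n a b c : ℕ} (h : (a, b, c) ∈ Omega n) (x y : Hn n)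
    (hxy : hammingDist x y = c) :
    (Finset.univ.filter fun z : Hn n => hammingDist x z = b ∧ hammingDist y z = a).card =
      tCount n a b c := by
  rw [mem_Omega] at h
  have hU : (supp (x - y)).card = c := by rw [card_supp, ← hxy, dist_eq_norm_sub]
  rw [tCount, ← hU, ← card_word_inter_sdiff, hU]
  refine Finset.card_equiv (Equiv.subLeft y) fun z => ?_
  simp only [Finset.mem_filter, Finset.mem_univ, true_and, Equiv.subLeft_apply]
  have e1 : hammingDist y z = hammingNorm (y - z) := dist_eq_norm_sub ..
  have e2 : hammingDist x z = hammingNorm ((y - z) - (x - y)) := by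
    rw [dist_eq_norm_sub]
    congr 1; funext i
    simp only [Pi.sub_apply]
    generalize x i = p; generalize y i = q; generalize z i = r
    revert p q r; decide
  have e3 := hammingNorm_sub_add (y - z) (x - y)
  have e4 := Finset.card_sdiff_add_card_inter (supp (y - z)) (supp (x - y))
  rw [card_supp] at e4 hU
  rw [e1, e2]
  omega

/-- With `A`, `B` the supports of `x - z`, `y - z`, parity comes from `c + 2|A ∩ B| = b + a`, the
triangle inequalities from the bounds on `|A ∩ B|`, and `a + b + c ≤ 2n` from `|A ∪ B| ≤ n`. -/
lemma mem_Omega_of_hasDists {n a b c : ℕ} {x y z : Hn n} (h : HasDists a b c x y z) :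
    (a, b, c) ∈ Omega n := by
  obtain ⟨rfl, rfl, rfl⟩ := h
  rw [mem_Omega]
  have h1 := hammingNorm_sub_add (x - z) (y - z)
  have h2 := card_supp_union_le (x - z) (y - z)
  have h3 := Finset.card_le_card (Finset.inter_subset_left (s₁ := supp (x - z)) (s₂ := supp (y - z)))
  have h4 := Finset.card_le_card (Finset.inter_subset_right (s₁ := supp (x - z)) (s₂ := supp (y - z)))
  rw [← hammingDist_eq_norm_sub, ← dist_eq_norm_sub, ← dist_eq_norm_sub] at h1
  rw [← dist_eq_norm_sub, ← dist_eq_norm_sub] at h2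
  rw [card_supp, ← dist_eq_norm_sub] at h3 h4
  omega

lemma mem_Omega_iff_exists {n a b c : ℕ} :
    (a, b, c) ∈ Omega n ↔ ∃ x y z : Hn n, HasDists a b c x y z := by
  refine ⟨fun h => ?_, fun ⟨x, y, z, h⟩ => mem_Omega_of_hasDists h⟩
  have h' := mem_Omega.1 h
  obtain ⟨u, hu⟩ := exists_hammingNorm_eq (n := n) (c := c) (by omega)
  have hd : hammingDist u 0 = c := by rw [dist_eq_norm_sub, sub_zero, hu]
  have hcard := card_dists h u 0 hd
  -- The inequalities defining `Ω` are what makes both binomial coefficients nonzero.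
  have hpos : 0 < tCount n a b c :=
    Nat.mul_pos (Nat.choose_pos (by omega)) (Nat.choose_pos (by omega))
  rw [← hcard, Finset.card_pos] at hpos
  obtain ⟨z, hz⟩ := hpos
  rw [Finset.mem_filter] at hz
  exact ⟨u, 0, z, hz.2.2, hz.2.1, hd⟩

/-! ### Invariance under coordinate permutations -/

/-- Two pairs of words with the same weights and distance differ by a coordinate permutation. -/
lemma exists_perm {n : ℕ} {u v u' v' : Hn n} (hu : hammingNorm u = hammingNorm u')
    (hv : hammingNorm v = hammingNorm v') (huv : hammingNorm (u - v) = hammingNorm (u' - v')) :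
    ∃ σ : Equiv.Perm (Fin n), u ∘ σ = u' ∧ v ∘ σ = v' := by
  -- The weights and the distance fix the sizes of all four cells of the Venn diagram of the two
  -- supports; bijections between corresponding cells glue to a permutation.
  have key : ∀ q : Prop × Prop,
      Nat.card {i // ((u' i ≠ 0 : Prop), (v' i ≠ 0 : Prop)) = q} =
        Nat.card {i // ((u i ≠ 0 : Prop), (v i ≠ 0 : Prop)) = q} := by
    have h1 := hammingNorm_sub_add u v
    have h2 := hammingNorm_sub_add u' v'
    have conv : ∀ (P : Fin n → Prop) (S : Finset (Fin n)), (∀ i, P i ↔ i ∈ S) →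
        Nat.card {i // P i} = S.card := by
      intro P S h
      rw [Nat.card_congr (Equiv.subtypeEquivRight h), Nat.card_eq_fintype_card, Fintype.card_coe]
    have a1 := Finset.card_sdiff_add_card_inter (supp u) (supp v)
    have a2 := Finset.card_sdiff_add_card_inter (supp v) (supp u)
    have a3 := Finset.card_sdiff_add_card_inter (supp u') (supp v')
    have a4 := Finset.card_sdiff_add_card_inter (supp v') (supp u')
    have b1 := Finset.card_union_add_card_inter (supp u) (supp v)
    have b2 := Finset.card_union_add_card_inter (supp u') (supp v')
    have c1 := Finset.card_compl (supp u ∪ supp v)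
    have c2 := Finset.card_compl (supp u' ∪ supp v')
    rw [Finset.inter_comm] at a2 a4
    rw [card_supp] at a1 a2 a3 a4
    rw [card_supp, card_supp] at b1 b2
    rintro ⟨p, q⟩
    rcases Classical.propComplete p with rfl | rfl <;>
      rcases Classical.propComplete q with rfl | rfl
    · rw [conv _ (supp u' ∩ supp v') (by simp [mem_supp]),
        conv _ (supp u ∩ supp v) (by simp [mem_supp])]
      omega
    · rw [conv _ (supp u' \ supp v') (by simp [mem_supp]),
        conv _ (supp u \ supp v) (by simp [mem_supp])]
      omega
    · rw [conv _ (supp v' \ supp u') (by simp [mem_supp, and_comm]),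
        conv _ (supp v \ supp u) (by simp [mem_supp, and_comm])]
      omega
    · rw [conv _ (supp u' ∪ supp v')ᶜ (by simp [mem_supp]),
        conv _ (supp u ∪ supp v)ᶜ (by simp [mem_supp])]
      omega
  let e := Equiv.ofFiberEquiv (f := fun i => ((u' i ≠ 0 : Prop), (v' i ≠ 0 : Prop)))
    (g := fun i => ((u i ≠ 0 : Prop), (v i ≠ 0 : Prop))) fun q => (Finite.card_eq.1 (key q)).some
  have he : ∀ i, ((u (e i) ≠ 0 : Prop), (v (e i) ≠ 0 : Prop)) =
      ((u' i ≠ 0 : Prop), (v' i ≠ 0 : Prop)) := fun i => Equiv.ofFiberEquiv_map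
      (f := fun i => ((u' i ≠ 0 : Prop), (v' i ≠ 0 : Prop)))
      (g := fun i => ((u i ≠ 0 : Prop), (v i ≠ 0 : Prop))) _ i
  have two : ∀ a b : ZMod 2, (a ≠ 0 ↔ b ≠ 0) → a = b := by decide
  refine ⟨e, funext fun i => two _ _ ?_, funext fun i => two _ _ ?_⟩
  · exact (congrArg Prod.fst (he i)).to_iff
  · exact (congrArg Prod.snd (he i)).to_iff

/-- The reproducing kernel of `harm n k` for the normalized inner product, up to the factor `2ⁿ`. -/
noncomputable def harmKernel (n k : ℕ) (x y : Hn n) : ℝ :=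
  ∑ s, (stdOrthonormalBasis ℝ (harm n k) s : EuclideanSpace ℝ (Hn n)) x *
    (stdOrthonormalBasis ℝ (harm n k) s : EuclideanSpace ℝ (Hn n)) y

lemma harmKernel_comm (n k : ℕ) (x y : Hn n) : harmKernel n k x y = harmKernel n k y x :=
  Finset.sum_congr rfl fun _ _ => mul_comm _ _

lemma harmKernel_mem (n k : ℕ) (y : Hn n) :
    WithLp.toLp 2 (fun x => harmKernel n k x y) ∈ harm n k := by
  have : WithLp.toLp 2 (fun x => harmKernel n k x y) =
      ∑ s, (stdOrthonormalBasis ℝ (harm n k) s : EuclideanSpace ℝ (Hn n)) y •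
        (stdOrthonormalBasis ℝ (harm n k) s : EuclideanSpace ℝ (Hn n)) := by
    ext x
    simp only [WithLp.ofLp_sum, WithLp.ofLp_smul, Finset.sum_apply, Pi.smul_apply, smul_eq_mul,
      harmKernel]
    exact Finset.sum_congr rfl fun _ _ => mul_comm _ _
  rw [this]
  exact Submodule.sum_mem _ fun s _ => Submodule.smul_mem _ _ (Submodule.coe_mem _)

/-- The reproducing property, read off the expansion of `f` in the orthonormal basis. It determines
the kernel from the space, independently of the basis. -/
lemma sum_mul_harmKernel (n k : ℕ) {f : EuclideanSpace ℝ (Hn n)} (hf : f ∈ harm n k) (y : Hn n) :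
    ∑ x, f x * harmKernel n k x y = f y := by
  have h := congrArg (fun g : harm n k => (g : EuclideanSpace ℝ (Hn n)) y)
    ((stdOrthonormalBasis ℝ (harm n k)).sum_repr' ⟨f, hf⟩)
  simp only [AddSubmonoidClass.coe_finsetSum, Submodule.coe_smul, WithLp.ofLp_sum,
    WithLp.ofLp_smul, Finset.sum_apply, Pi.smul_apply, smul_eq_mul, Submodule.coe_inner,
    PiLp.inner_apply, RCLike.inner_apply, conj_trivial] at h
  rw [← h]
  simp only [harmKernel, Finset.mul_sum, Finset.sum_mul]
  rw [Finset.sum_comm]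
  exact Finset.sum_congr rfl fun _ _ => Finset.sum_congr rfl fun _ _ => by ring

/-- Coordinate permutations of words. -/
def permWord {n : ℕ} (σ : Equiv.Perm (Fin n)) : Hn n ≃ Hn n := σ.arrowCongr (Equiv.refl _) |>.symm

lemma permWord_apply {n : ℕ} (σ : Equiv.Perm (Fin n)) (x : Hn n) : permWord σ x = x ∘ σ := rfl

lemma hammingNorm_permWord {n : ℕ} (σ : Equiv.Perm (Fin n)) (x : Hn n) :
    hammingNorm (permWord σ x) = hammingNorm x := by
  refine Finset.card_equiv σ fun i => ?_
  simp only [Finset.mem_filter, Finset.mem_univ, true_and]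
  rfl

lemma sub_permWord {n : ℕ} (σ : Equiv.Perm (Fin n)) (x y : Hn n) :
    Sub (permWord σ x) (permWord σ y) ↔ Sub x y :=
  ⟨fun h i => by simpa [permWord_apply] using h (σ.symm i), fun h i => h (σ i)⟩

lemma comp_permWord_mem_harm {n k : ℕ} (σ : Equiv.Perm (Fin n)) {f : EuclideanSpace ℝ (Hn n)}
    (hf : f ∈ harm n k) : WithLp.toLp 2 (fun x => f (permWord σ x)) ∈ harm n k := by
  refine ⟨fun x hx => hf.1 _ (by rwa [hammingNorm_permWord]), fun z hz => ?_⟩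
  rw [← hf.2 (permWord σ z) (by rwa [hammingNorm_permWord])]
  refine Finset.sum_equiv (permWord σ) (fun x => ?_) (fun x _ => rfl)
  simp [hammingNorm_permWord, sub_permWord]

/-- Uniqueness of a reproducing kernel: `∑_t K(σt, σy) K(t, x)` equals `K(σx, σy)` by reproducing
the first factor, and `K(y, x)` by reproducing the second after reindexing by `σ`. -/
lemma harmKernel_permWord (n k : ℕ) (σ : Equiv.Perm (Fin n)) (x y : Hn n) :
    harmKernel n k (permWord σ x) (permWord σ y) = harmKernel n k x y := by
  have hf : WithLp.toLp 2 (fun t => harmKernel n k (permWord σ t) (permWord σ y)) ∈ harm n k :=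
    comp_permWord_mem_harm σ (harmKernel_mem n k (permWord σ y))
  have h1 := sum_mul_harmKernel n k hf x
  have h2 := sum_mul_harmKernel n k
    (comp_permWord_mem_harm σ.symm (harmKernel_mem n k x)) (permWord σ y)
  have e : ∀ z : Hn n, permWord σ.symm (permWord σ z) = z := fun z => by
    funext i; simp [permWord_apply]
  simp only [e] at h2
  rw [← (permWord σ).sum_comp] at h2
  simp only [e] at h2
  change _ = harmKernel n k (permWord σ x) (permWord σ y) at h1
  rw [← h1, harmKernel_comm n k x y, ← h2]
  exact Finset.sum_congr rfl fun t _ => mul_comm _ _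

/-- Eliminates the basis in favour of the kernel; `2 ^ n` is the product of the two normalizing
factors `√(2ⁿ)`. -/
lemma zonalE_apply (n k : ℕ) (x y : Hn n) (i j : Fin (n - 2 * k + 1)) :
    zonalE n k x y i j = if hammingNorm x = k + i ∧ hammingNorm y = k + j then
      2 ^ n * ∑ x' : Hn n with hammingNorm x' = k ∧ Sub x' x,
        ∑ y' : Hn n with hammingNorm y' = k ∧ Sub y' y, harmKernel n k x' y' else 0 := by
  simp only [zonalE, Matrix.of_apply, isoVec]
  by_cases hx : hammingNorm x = k + i
  · by_cases hy : hammingNorm y = k + j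
    · simp only [hx, hy, and_self, if_true, basisVec, harmKernel, Finset.sum_mul_sum]
      rw [Finset.sum_comm, Finset.mul_sum]
      refine Finset.sum_congr rfl fun x' _ => ?_
      rw [Finset.sum_comm, Finset.mul_sum]
      refine Finset.sum_congr rfl fun y' _ => ?_
      rw [Finset.mul_sum]
      refine Finset.sum_congr rfl fun s _ => ?_
      rw [mul_mul_mul_comm, Real.mul_self_sqrt (by positivity)]
    · simp [hy]
  · simp [hx]

lemma zonalE_permWord (n k : ℕ) (σ : Equiv.Perm (Fin n)) (x y : Hn n) :
    zonalE n k (permWord σ x) (permWord σ y) = zonalE n k x y := by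
  ext i j
  rw [zonalE_apply, zonalE_apply, hammingNorm_permWord, hammingNorm_permWord]
  congr 2
  symm
  refine Finset.sum_equiv (permWord σ) (fun x => ?_) (fun x' _ => ?_)
  · simp [hammingNorm_permWord, sub_permWord]
  · refine Finset.sum_equiv (permWord σ) (fun y => ?_) (fun y' _ => ?_)
    · simp [hammingNorm_permWord, sub_permWord]
    · exact (harmKernel_permWord n k σ x' y').symm

lemma zonalE_congr (n k : ℕ) {u v u' v' : Hn n} (hu : hammingNorm u = hammingNorm u')
    (hv : hammingNorm v = hammingNorm v') (huv : hammingNorm (u - v) = hammingNorm (u' - v')) :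
    zonalE n k u v = zonalE n k u' v' := by
  obtain ⟨σ, rfl, rfl⟩ := exists_perm hu hv huv
  exact (zonalE_permWord n k σ u v).symm

lemma zonalF_eq_matT (n k : ℕ) (x y z : Hn n) :
    zonalF n k x y z = matT n k (hammingDist y z) (hammingDist x z) (hammingDist x y) := by
  have h : ∃ p : Hn n × Hn n × Hn n, HasDists (hammingDist y z) (hammingDist x z)
      (hammingDist x y) p.1 p.2.1 p.2.2 := ⟨(x, y, z), rfl, rfl, rfl⟩
  rw [matT, dif_pos h]
  obtain ⟨h1, h2, h3⟩ := h.choose_spec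
  refine zonalE_congr n k ?_ ?_ ?_
  · rw [← dist_eq_norm_sub, ← dist_eq_norm_sub, h2]
  · rw [← dist_eq_norm_sub, ← dist_eq_norm_sub, h1]
  · rw [← hammingDist_eq_norm_sub, ← hammingDist_eq_norm_sub, h3]

lemma sum_zonalE_eq (n k : ℕ) (x y : Hn n) :
    ∑ z : Hn n, zonalE n k (x - z) (y - z) =
      ∑ p ∈ (Omega n).filter (fun p => p.2.2 = hammingDist x y),
        (tCount n p.1 p.2.1 p.2.2 : ℝ) • matT n k p.1 p.2.1 p.2.2 := by
  have hmap : ∀ z ∈ (Finset.univ : Finset (Hn n)),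
      (hammingDist y z, hammingDist x z, hammingDist x y) ∈
        (Omega n).filter (fun p => p.2.2 = hammingDist x y) := fun z _ =>
    Finset.mem_filter.2 ⟨mem_Omega_of_hasDists ⟨rfl, rfl, rfl⟩, rfl⟩
  rw [← Finset.sum_fiberwise_of_maps_to hmap]
  refine Finset.sum_congr rfl fun p hp => ?_
  obtain ⟨a, b, c⟩ := p
  obtain ⟨hp, hc⟩ := Finset.mem_filter.1 hp
  simp only at hc
  subst hc
  rw [← card_dists hp x y rfl, Nat.cast_smul_eq_nsmul, ← Finset.sum_const]
  refine Finset.sum_congr (Finset.filter_congr fun z _ => ?_) fun z hz => ?_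
  · simp [and_comm]
  · simp only [Finset.mem_filter] at hz
    rw [← hz.2.1, ← hz.2.2]
    exact zonalF_eq_matT n k x y z

/-! ### Counting triples in a code -/

/-- The number of triples in a code with prescribed distances. -/
def tripleCount {n : ℕ} (C : Finset (Hn n)) (a b c : ℕ) : ℕ :=
  ((C ×ˢ C ×ˢ C).filter fun p => HasDists a b c p.1 p.2.1 p.2.2).card

/-- The number of pairs in a code at a prescribed distance. -/
def pairCount {n : ℕ} (C : Finset (Hn n)) (c : ℕ) : ℕ :=
  ((C ×ˢ C).filter fun p => hammingDist p.1 p.2 = c).card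

lemma tripleDist_eq {n : ℕ} (C : Finset (Hn n)) (a b c : ℕ) :
    tripleDist C a b c = (tripleCount C a b c : ℝ) / C.card := rfl

lemma tripleCount_swap_left {n : ℕ} (C : Finset (Hn n)) (a b c : ℕ) :
    tripleCount C a b c = tripleCount C b a c := by
  refine Finset.card_nbij' (fun p => (p.2.1, p.1, p.2.2)) (fun p => (p.2.1, p.1, p.2.2))
    ?_ ?_ (fun _ _ => rfl) (fun _ _ => rfl) <;>
  · rintro ⟨x, y, z⟩ h
    simp only [Finset.coe_filter, Finset.mem_product, Set.mem_ofPred_eq] at h ⊢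
    simp only [HasDists, hammingDist_comm y x] at h ⊢
    tauto

lemma tripleCount_swap_right {n : ℕ} (C : Finset (Hn n)) (a b c : ℕ) :
    tripleCount C a b c = tripleCount C a c b := by
  refine Finset.card_nbij' (fun p => (p.1, p.2.2, p.2.1)) (fun p => (p.1, p.2.2, p.2.1))
    ?_ ?_ (fun _ _ => rfl) (fun _ _ => rfl) <;>
  · rintro ⟨x, y, z⟩ h
    simp only [Finset.coe_filter, Finset.mem_product, Set.mem_ofPred_eq] at h ⊢
    simp only [HasDists, hammingDist_comm z y] at h ⊢
    tauto

lemma tripleCount_zero {n : ℕ} (C : Finset (Hn n)) (c : ℕ) :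
    tripleCount C 0 c c = pairCount C c := by
  refine Finset.card_nbij' (fun p => (p.1, p.2.1)) (fun p => (p.1, p.2, p.2)) ?_ ?_ ?_
    (fun _ _ => rfl)
  · rintro ⟨x, y, z⟩ h
    simp only [Finset.coe_filter, Finset.mem_product, Set.mem_ofPred_eq] at h ⊢
    exact ⟨⟨h.1.1, h.1.2.1⟩, h.2.2.2⟩
  · rintro ⟨x, y⟩ h
    simp only [Finset.coe_filter, Finset.mem_product, Set.mem_ofPred_eq] at h ⊢
    exact ⟨⟨h.1.1, h.1.2, h.1.2⟩, hammingDist_self y, h.2, h.2⟩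
  · rintro ⟨x, y, z⟩ h
    simp only [Finset.coe_filter, Set.mem_ofPred_eq] at h
    rw [hammingDist_eq_zero.1 h.2.1]

/-- The fibre of `(x, y, z) ↦ (x, y)` embeds into the set of all `z` counted by `t(a, b, c)`. -/
lemma tripleCount_le {n a b c : ℕ} (h : (a, b, c) ∈ Omega n) (C : Finset (Hn n)) :
    tripleCount C a b c ≤ tCount n a b c * pairCount C c := by
  have hmap : ∀ p ∈ (C ×ˢ C ×ˢ C).filter (fun p => HasDists a b c p.1 p.2.1 p.2.2),
      (p.1, p.2.1) ∈ (C ×ˢ C).filter fun p => hammingDist p.1 p.2 = c := by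
    rintro ⟨x, y, z⟩ hp
    simp only [Finset.mem_filter, Finset.mem_product] at hp ⊢
    exact ⟨⟨hp.1.1, hp.1.2.1⟩, hp.2.2.2⟩
  refine Finset.card_le_mul_card_image_of_maps_to hmap _ ?_
  rintro ⟨x, y⟩ hxy
  simp only [Finset.mem_filter] at hxy
  rw [← card_dists h x y hxy.2]
  refine Finset.card_le_card_of_injOn (fun p => p.2.2) ?_ ?_
  · rintro ⟨x', y', z⟩ hp
    simp only [Finset.coe_filter, Finset.mem_filter, Set.mem_ofPred_eq,
      Prod.mk.injEq] at hp
    obtain ⟨⟨-, h1, h2, -⟩, rfl, rfl⟩ := hp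
    simp [h1, h2]
  · rintro ⟨x', y', z⟩ hp ⟨x'', y'', z'⟩ hp' hz
    simp only [Finset.coe_filter, Finset.mem_filter, Set.mem_ofPred_eq,
      Prod.mk.injEq] at hp hp'
    obtain ⟨-, rfl, rfl⟩ := hp
    obtain ⟨-, rfl, rfl⟩ := hp'
    simp only at hz
    rw [hz]

lemma sum_pairCount {n : ℕ} (C : Finset (Hn n)) :
    ∑ c ∈ Finset.range (n + 1), pairCount C c = C.card * C.card := by
  rw [← Finset.card_product]
  refine (Finset.card_eq_sum_card_fiberwise fun p _ => ?_).symm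
  rw [Finset.mem_coe, Finset.mem_range, dist_eq_norm_sub, Nat.lt_succ_iff]
  exact hammingNorm_le_dim _

/-! ### The two semidefinite conditions as sums of `F_k` -/

lemma card_smul_sdpMatrix₁ {n : ℕ} (k : ℕ) {C : Finset (Hn n)} (hC : C.Nonempty) :
    (C.card : ℝ) • sdpMatrix₁ n k (tripleDist C) =
      ∑ x ∈ C, ∑ y ∈ C, ∑ z ∈ C, zonalF n k x y z := by
  have hmap : ∀ p ∈ C ×ˢ C ×ˢ C, (hammingDist p.2.1 p.2.2, hammingDist p.1 p.2.2,
      hammingDist p.1 p.2.1) ∈ Omega n := fun p _ => mem_Omega_of_hasDists ⟨rfl, rfl, rfl⟩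
  have hC' : (C.card : ℝ) ≠ 0 := by exact_mod_cast hC.card_ne_zero
  have h : ∑ x ∈ C, ∑ y ∈ C, ∑ z ∈ C, zonalF n k x y z =
      ∑ p ∈ C ×ˢ C ×ˢ C, zonalF n k p.1 p.2.1 p.2.2 := by
    simp only [Finset.sum_product]
  rw [h, ← Finset.sum_fiberwise_of_maps_to hmap, sdpMatrix₁, Finset.smul_sum]
  refine Finset.sum_congr rfl fun q _ => ?_
  obtain ⟨a, b, c⟩ := q
  rw [smul_smul, tripleDist, mul_div_cancel₀ _ hC', Nat.cast_smul_eq_nsmul, ← Finset.sum_const]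
  refine Finset.sum_congr (Finset.filter_congr fun p _ => ?_) fun p hp => ?_
  · simp [HasDists]
  · simp only [Finset.mem_filter, Prod.mk.injEq] at hp
    rw [zonalF_eq_matT, hp.2.1, hp.2.2.1, hp.2.2.2]

lemma sum_zonalF_univ (n k : ℕ) (x y : Hn n) :
    ∑ z : Hn n, zonalF n k x y z =
      ∑ p ∈ (Omega n).filter (fun p => p.2.2 = hammingDist x y),
        (tCount n p.1 p.2.1 p.2.2 : ℝ) • matT n k p.1 p.2.1 p.2.2 :=
  sum_zonalE_eq n k x y

lemma sdpMatrix_add (n k : ℕ) (x : ℕ → ℕ → ℕ → ℝ) :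
    sdpMatrix₁ n k x + sdpMatrix₂ n k x =
      ∑ p ∈ Omega n, ((tCount n p.1 p.2.1 p.2.2 : ℝ) * x 0 p.2.2 p.2.2) •
        matT n k p.1 p.2.1 p.2.2 := by
  rw [sdpMatrix₁, sdpMatrix₂, ← Finset.sum_add_distrib]
  refine Finset.sum_congr rfl fun p _ => ?_
  rw [← add_smul, add_sub_cancel]

/-- The matrix `∑_z E_k(x - z, y - z)` for `d(x, y) = c`. -/
noncomputable def pairMatrix (n k c : ℕ) :
    Matrix (Fin (n - 2 * k + 1)) (Fin (n - 2 * k + 1)) ℝ :=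
  ∑ p ∈ (Omega n).filter (fun p => p.2.2 = c),
    (tCount n p.1 p.2.1 p.2.2 : ℝ) • matT n k p.1 p.2.1 p.2.2

lemma sdpMatrix_add_eq_sum_pairMatrix (n k : ℕ) (x : ℕ → ℕ → ℕ → ℝ) :
    sdpMatrix₁ n k x + sdpMatrix₂ n k x =
      ∑ c ∈ Finset.range (n + 1), x 0 c c • pairMatrix n k c := by
  have hmap : ∀ p ∈ Omega n, p.2.2 ∈ Finset.range (n + 1) := by
    rintro ⟨a, b, c⟩ hp
    rw [mem_Omega] at hp
    rw [Finset.mem_range]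
    simp only
    omega
  rw [sdpMatrix_add, ← Finset.sum_fiberwise_of_maps_to hmap]
  refine Finset.sum_congr rfl fun c _ => ?_
  rw [pairMatrix, Finset.smul_sum]
  refine Finset.sum_congr rfl fun p hp => ?_
  rw [smul_smul, (Finset.mem_filter.1 hp).2, mul_comm (x 0 c c)]

/-- `|C| x_{0,c,c}` counts the ordered pairs of `C` at distance `c`, and for each of them the sum
over all `z` is `pairMatrix n k c`. -/
lemma sum_code_pairMatrix {n : ℕ} (k : ℕ) {C : Finset (Hn n)} (hC : C.Nonempty) :
    (C.card : ℝ) • (sdpMatrix₁ n k (tripleDist C) + sdpMatrix₂ n k (tripleDist C)) =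
      ∑ x ∈ C, ∑ y ∈ C, ∑ z : Hn n, zonalF n k x y z := by
  have hC' : (C.card : ℝ) ≠ 0 := by exact_mod_cast hC.card_ne_zero
  have hmap : ∀ p ∈ C ×ˢ C, hammingDist p.1 p.2 ∈ Finset.range (n + 1) := fun p _ => by
    rw [Finset.mem_range, dist_eq_norm_sub, Nat.lt_succ_iff]
    exact hammingNorm_le_dim _
  rw [sdpMatrix_add_eq_sum_pairMatrix, Finset.smul_sum, ← Finset.sum_product',
    ← Finset.sum_fiberwise_of_maps_to hmap]
  refine Finset.sum_congr rfl fun c _ => ?_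
  rw [tripleDist_eq, tripleCount_zero, smul_smul, mul_div_cancel₀ _ hC', pairCount,
    Nat.cast_smul_eq_nsmul, ← Finset.sum_const]
  refine Finset.sum_congr rfl fun p hp => ?_
  rw [sum_zonalF_univ, (Finset.mem_filter.1 hp).2, pairMatrix]

lemma card_smul_sdpMatrix₂ {n : ℕ} (k : ℕ) {C : Finset (Hn n)} (hC : C.Nonempty) :
    (C.card : ℝ) • sdpMatrix₂ n k (tripleDist C) =
      ∑ x ∈ C, ∑ y ∈ C, ∑ z ∈ Cᶜ, zonalF n k x y z := by
  have h := sum_code_pairMatrix k hC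
  simp only [← Finset.sum_add_sum_compl C, Finset.sum_add_distrib] at h
  rw [smul_add, card_smul_sdpMatrix₁ k hC] at h
  exact add_left_cancel h

/-! ### Codes give feasible points -/

/-- A sum of matrices `∑_s v_s v_sᵀ` is positive semidefinite. -/
lemma posSemidef_sum_mul {ι κ : Type*} [Fintype ι] [Fintype κ] (v : κ → ι → ℝ) :
    (Matrix.of fun i j => ∑ s, v s i * v s j : Matrix ι ι ℝ).PosSemidef := by
  have : (Matrix.of fun i j => ∑ s, v s i * v s j : Matrix ι ι ℝ) =
      ∑ s, Matrix.vecMulVec (v s) (star (v s)) := by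
    ext i j
    simp [Matrix.sum_apply, Matrix.vecMulVec_apply]
  rw [this]
  exact Matrix.posSemidef_sum _ fun s _ => Matrix.posSemidef_vecMulVec_self_star _

/-- For fixed `z` the double sum over `C × C` factors as `∑_s v_s v_sᵀ` with `v_s = ∑_{x ∈ C}
e_{k,·,s}(x - z)`. The set `D` will be `C` for (5) and `Cᶜ` for (6). -/
lemma posSemidef_sum_zonalF {n : ℕ} (k : ℕ) (C D : Finset (Hn n)) :
    (∑ x ∈ C, ∑ y ∈ C, ∑ z ∈ D, zonalF n k x y z).PosSemidef := by
  have : ∑ x ∈ C, ∑ y ∈ C, ∑ z ∈ D, zonalF n k x y z = ∑ z ∈ D,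
      (Matrix.of fun i j : Fin (n - 2 * k + 1) => ∑ s,
         (∑ x ∈ C, isoVec n k (k + i) s (x - z)) * (∑ x ∈ C, isoVec n k (k + j) s (x - z))) := by
    simp_rw [Finset.sum_comm (s := C) (t := D)]
    refine Finset.sum_congr rfl fun z _ => ?_
    ext i j
    simp only [Matrix.sum_apply, zonalF, zonalE, Matrix.of_apply, Finset.sum_mul_sum]
    rw [Finset.sum_comm (s := Finset.univ)]
    exact Finset.sum_congr rfl fun x _ => Finset.sum_comm
  rw [this]
  exact Matrix.posSemidef_sum _ fun z _ => posSemidef_sum_mul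
    fun s (i : Fin (n - 2 * k + 1)) => ∑ x ∈ C, isoVec n k (k + i) s (x - z)

lemma posSemidef_of_smul {ι : Type*} [Fintype ι] {A : Matrix ι ι ℝ} {r : ℝ} (hr : 0 < r)
    (h : (r • A).PosSemidef) : A.PosSemidef := by
  have := h.smul (inv_nonneg.2 hr.le)
  rwa [smul_smul, inv_mul_cancel₀ hr.ne', one_smul] at this

lemma sdpObjective_tripleDist {n : ℕ} {C : Finset (Hn n)} (hC : C.Nonempty) :
    (C.card : ℝ) = sdpObjective n (tripleDist C) := by
  have hC' : (C.card : ℝ) ≠ 0 := by exact_mod_cast hC.card_ne_zero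
  simp only [sdpObjective, tripleDist_eq, tripleCount_zero]
  rw [← Finset.sum_div, ← Nat.cast_sum, sum_pairCount, Nat.cast_mul, mul_div_cancel_right₀ _ hC']

lemma sdpFeasible_tripleDist {n δ : ℕ} {C : Finset (Hn n)} (hC : C.Nonempty)
    (hδ : MinDistGE δ C) : SDPFeasible n δ (tripleDist C) := by
  have hpos : (0 : ℝ) < C.card := by exact_mod_cast hC.card_pos
  have hle : ∀ a b c, (a, b, c) ∈ Omega n →
      tripleDist C a b c ≤ tCount n a b c * tripleDist C 0 c c := fun a b c h => by
    rw [tripleDist_eq, tripleDist_eq, tripleCount_zero, ← mul_div_assoc]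
    gcongr
    exact_mod_cast tripleCount_le h C
  have hs : ∀ a b c, tripleDist C a b c = tripleDist C b a c := fun a b c => by
    rw [tripleDist_eq, tripleDist_eq, tripleCount_swap_left]
  have hs' : ∀ a b c, tripleDist C a b c = tripleDist C a c b := fun a b c => by
    rw [tripleDist_eq, tripleDist_eq, tripleCount_swap_right]
  have hrot : ∀ a b c, tripleDist C a b c = tripleDist C b c a := fun a b c => by
    rw [hs a b c, hs' b a c]
  refine ⟨?_, ?_, ?_, ?_, ?_, ?_, ?_⟩
  · rw [tripleDist_eq, tripleCount_zero, div_eq_one_iff_eq hpos.ne', Nat.cast_inj]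
    refine Finset.card_nbij' (fun p => p.1) (fun x => (x, x)) ?_ ?_ ?_ (fun _ _ => rfl)
    · rintro ⟨x, y⟩ h
      simp only [Finset.coe_filter, Finset.mem_product, Set.mem_ofPred_eq] at h
      exact h.1.1
    · intro x h
      simpa using h
    · rintro ⟨x, y⟩ h
      simp only [Finset.coe_filter, Set.mem_ofPred_eq, hammingDist_eq_zero] at h
      rw [h.2]
  · intro a b c _
    rw [tripleDist_eq]
    positivity
  · intro a b c _
    refine ⟨hs' a b c, hs a b c, hrot a b c, ?_, ?_⟩
    · rw [hrot, hrot]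
    · rw [hrot, hs]
  · intro a b c h
    refine ⟨hle a b c h, ?_, ?_⟩
    · rw [hrot]
      refine hle b c a ?_
      rw [mem_Omega] at h ⊢
      omega
    · rw [hrot, hrot]
      refine hle c a b ?_
      rw [mem_Omega] at h ⊢
      omega
  · intro k _
    refine posSemidef_of_smul hpos ?_
    rw [card_smul_sdpMatrix₁ k hC]
    exact posSemidef_sum_zonalF k C C
  · intro k _
    refine posSemidef_of_smul hpos ?_
    rw [card_smul_sdpMatrix₂ k hC]
    exact posSemidef_sum_zonalF k C Cᶜ
  · intro a b c _ h
    rw [tripleDist_eq, div_eq_zero_iff, Nat.cast_eq_zero]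
    left
    rw [tripleCount, Finset.card_eq_zero, Finset.filter_eq_empty_iff]
    rintro ⟨x, y, z⟩ hp ⟨rfl, rfl, rfl⟩
    simp only [Finset.mem_product] at hp
    have key : ∀ u ∈ C, ∀ v ∈ C, ¬(0 < hammingDist u v ∧ hammingDist u v < δ) :=
      fun u hu v hv hd => absurd (hδ u hu v hv (hammingDist_pos.1 hd.1)) (not_le.2 hd.2)
    rcases h with h | h | h
    · exact key _ hp.2.1 _ hp.2.2 h
    · exact key _ hp.1 _ hp.2.2 h
    · exact key _ hp.1 _ hp.2.1 h

lemma card_le_sdpBound {n δ : ℕ} {C : Finset (Hn n)} (hδ : MinDistGE δ C) :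
    ((C.card : ℝ) : EReal) ≤ sdpBound n δ := by
  have main : ∀ D : Finset (Hn n), D.Nonempty → MinDistGE δ D →
      ((D.card : ℝ) : EReal) ≤ sdpBound n δ := fun D hD h =>
    le_sSup ⟨tripleDist D, sdpFeasible_tripleDist hD h, by rw [← sdpObjective_tripleDist hD]⟩
  -- The distribution of the empty code is `0 / 0 = 0`, which violates (1); the code `{0}` gives the
  -- bound instead.
  rcases C.eq_empty_or_nonempty with rfl | hC
  · refine le_trans ?_ (main {0} (Finset.singleton_nonempty 0) ?_)
    · simp
    · intro c hc c' hc' hne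
      rw [Finset.mem_singleton] at hc hc'
      exact absurd (hc.trans hc'.symm) hne
  · exact main C hC hδ

/-! ### Fourier analysis on `𝔽₂ⁿ` and Krawtchouk polynomials -/

/-- The character `(-1)^{w·u}` of the binary Hamming space. -/
def chr {n : ℕ} (w u : Hn n) : ℝ := ∏ i, if w i ≠ 0 ∧ u i ≠ 0 then -1 else 1

lemma chr_comm {n : ℕ} (w u : Hn n) : chr w u = chr u w :=
  Finset.prod_congr rfl fun i _ => by simp only [and_comm]

lemma chr_add {n : ℕ} (w u v : Hn n) : chr w (u + v) = chr w u * chr w v := by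
  rw [chr, chr, chr, ← Finset.prod_mul_distrib]
  refine Finset.prod_congr rfl fun i _ => ?_
  have h : ∀ a b c : ZMod 2, (if a ≠ 0 ∧ b + c ≠ 0 then -1 else 1 : ℤ) =
      (if a ≠ 0 ∧ b ≠ 0 then -1 else 1) * (if a ≠ 0 ∧ c ≠ 0 then -1 else 1) := by decide
  exact_mod_cast congrArg (Int.cast : ℤ → ℝ) (h (w i) (u i) (v i))

lemma chr_eq_neg_one_pow {n : ℕ} (w u : Hn n) : chr w u = (-1) ^ (supp w ∩ supp u).card := by
  rw [chr, Finset.prod_ite, Finset.prod_const, Finset.prod_const_one, mul_one]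
  congr 2
  ext i
  simp [mem_supp]

lemma sum_chr {n : ℕ} (u : Hn n) : ∑ w, chr w u = if u = 0 then 2 ^ n else 0 := by
  have h : ∑ w, chr w u = ∏ i, ∑ a : ZMod 2, if a ≠ 0 ∧ u i ≠ 0 then (-1 : ℝ) else 1 := by
    rw [Finset.prod_univ_sum, Fintype.piFinset_univ]
    rfl
  have h2 : ∀ b : ZMod 2, (∑ a : ZMod 2, if a ≠ 0 ∧ b ≠ 0 then (-1 : ℝ) else 1) =
      if b = 0 then 2 else 0 := fun b => by
    rw [show (Finset.univ : Finset (ZMod 2)) = {0, 1} from rfl, Finset.sum_pair (by decide)]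
    by_cases hb : b = 0 <;> simp [hb]; norm_num
  rw [h]
  simp only [h2]
  split_ifs with hu
  · subst hu; simp
  · obtain ⟨i, hi⟩ := Function.ne_iff.1 hu
    exact Finset.prod_eq_zero (Finset.mem_univ i) (if_neg hi)

lemma word_add_eq_zero {n : ℕ} (u v : Hn n) : u + v = 0 ↔ u = v := by
  have h : ∀ a b : ZMod 2, a + b = 0 ↔ a = b := by decide
  simp only [funext_iff, Pi.add_apply, Pi.zero_apply, h]

lemma word_sub_eq_add {n : ℕ} (u v : Hn n) : u - v = u + v := by
  have h : ∀ a b : ZMod 2, a - b = a + b := by decide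
  funext i; exact h _ _

/-- The Fourier transform on the binary Hamming space. -/
def fourier {n : ℕ} (f : Hn n → ℝ) (w : Hn n) : ℝ := ∑ u, f u * chr w u

/-- Expand the transforms on the right: orthogonality of characters keeps only the terms with `p = u
+ q`, each with factor `2ⁿ`. -/
lemma autocorrelation_eq {n : ℕ} (f g : Hn n → ℝ) (u : Hn n) :
    2 ^ n * ∑ z, f (u + z) * g z = ∑ w, fourier f w * fourier g w * chr w u := by
  have h : ∀ w, fourier f w * fourier g w * chr w u =
      ∑ p, ∑ q, f p * g q * chr w (p + (u + q)) := fun w => by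
    rw [fourier, fourier, Finset.sum_mul_sum, Finset.sum_mul]
    refine Finset.sum_congr rfl fun p _ => ?_
    rw [Finset.sum_mul]
    refine Finset.sum_congr rfl fun q _ => ?_
    rw [chr_add, chr_add]
    ring
  simp only [h]
  rw [Finset.sum_comm]
  simp_rw [Finset.sum_comm (s := Finset.univ) (t := Finset.univ) (f := fun w q => f _ * g q * _),
    ← Finset.mul_sum, sum_chr, word_add_eq_zero]
  rw [Finset.sum_comm, Finset.mul_sum]
  refine Finset.sum_congr rfl fun q _ => ?_
  simp
  ring

/-- Group the words `w` by `i = |supp w ∩ supp u|`: the character is `(-1)^i` on each class. -/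
lemma sum_chr_sphere {n : ℕ} (m : ℕ) (u : Hn n) :
    ∑ w : Hn n with hammingNorm w = m, chr w u = krawtchouk n m (hammingNorm u) := by
  have hmap : ∀ w ∈ (Finset.univ : Finset (Hn n)).filter (fun w => hammingNorm w = m),
      (supp w ∩ supp u).card ∈ Finset.range (m + 1) := fun w hw => by
    rw [Finset.mem_range, Nat.lt_succ_iff, ← (Finset.mem_filter.1 hw).2]
    exact Finset.card_le_card Finset.inter_subset_left
  rw [← Finset.sum_fiberwise_of_maps_to hmap, krawtchouk]
  refine Finset.sum_congr rfl fun i hi => ?_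
  rw [Finset.mem_range] at hi
  rw [mul_assoc, ← Nat.cast_mul, ← card_supp, ← card_word_inter_sdiff, mul_comm,
    ← nsmul_eq_mul, ← Finset.sum_const, Finset.filter_filter]
  refine Finset.sum_congr (Finset.filter_congr fun w _ => ?_) fun w hw => ?_
  · have := Finset.card_sdiff_add_card_inter (supp w) (supp u)
    rw [card_supp] at this
    omega
  · rw [chr_eq_neg_one_pow, (Finset.mem_filter.1 hw).2.1]

lemma card_sphere (n c : ℕ) :
    ((Finset.univ : Finset (Hn n)).filter fun u => hammingNorm u = c).card = n.choose c := by
  have h := card_word_inter_sdiff (∅ : Finset (Fin n)) 0 c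
  simpa [card_supp] using h

/-- Sum the symmetric function `chr u w` over the product of the spheres of radii `m` and `c`, in
both orders. -/
lemma choose_mul_krawtchouk (n c m : ℕ) :
    (n.choose m : ℝ) * krawtchouk n c m = n.choose c * krawtchouk n m c := by
  have h : ∀ p q : ℕ, ∑ w : Hn n with hammingNorm w = p, ∑ u : Hn n with hammingNorm u = q,
      chr u w = n.choose p * krawtchouk n q p := fun p q => by
    rw [← card_sphere, ← nsmul_eq_mul, ← Finset.sum_const]
    refine Finset.sum_congr rfl fun w hw => ?_
    rw [sum_chr_sphere, (Finset.mem_filter.1 hw).2]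
  rw [← h m c, ← h c m, Finset.sum_comm]
  exact Finset.sum_congr rfl fun u _ => Finset.sum_congr rfl fun w _ => chr_comm _ _

/-! ### Krawtchouk inequalities imply semidefiniteness -/

lemma pairMatrix_eq_sum (n k : ℕ) (u : Hn n) :
    pairMatrix n k (hammingNorm u) = ∑ z : Hn n, zonalE n k (u + z) z := by
  have h := sum_zonalE_eq n k u 0
  rw [dist_eq_norm_sub, sub_zero] at h
  rw [pairMatrix, ← h]
  refine Finset.sum_congr rfl fun z _ => ?_
  rw [word_sub_eq_add, word_sub_eq_add, zero_add]

/-- The positive semidefinite matrix of Fourier coefficients of the functions `e_{k,i,s}`. -/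
noncomputable def fourierMatrix (n k : ℕ) (w : Hn n) :
    Matrix (Fin (n - 2 * k + 1)) (Fin (n - 2 * k + 1)) ℝ :=
  Matrix.of fun i j => ∑ s, fourier (isoVec n k (k + i) s) w * fourier (isoVec n k (k + j) s) w

lemma posSemidef_fourierMatrix (n k : ℕ) (w : Hn n) : (fourierMatrix n k w).PosSemidef :=
  posSemidef_sum_mul fun s (i : Fin (n - 2 * k + 1)) => fourier (isoVec n k (k + i) s) w

lemma two_pow_smul_pairMatrix (n k : ℕ) (u : Hn n) :
    (2 ^ n : ℝ) • pairMatrix n k (hammingNorm u) = ∑ w, chr w u • fourierMatrix n k w := by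
  ext i j
  simp only [pairMatrix_eq_sum, Matrix.smul_apply, Matrix.sum_apply, zonalE, fourierMatrix,
    Matrix.of_apply, smul_eq_mul]
  rw [Finset.sum_comm, Finset.mul_sum]
  simp only [autocorrelation_eq]
  rw [Finset.sum_comm]
  refine Finset.sum_congr rfl fun w _ => ?_
  rw [Finset.mul_sum]
  exact Finset.sum_congr rfl fun s _ => mul_comm _ _

/-- `P_c` does not depend on the choice of `u` of weight `c`, so summing over that sphere replaces
characters by `K_c(wt w)`; `choose_mul_krawtchouk` then exchanges degree and argument, as the
Delsarte inequalities require. -/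
lemma two_pow_smul_pairMatrix' {n k c : ℕ} (hc : c ≤ n) :
    (2 ^ n : ℝ) • pairMatrix n k c =
      ∑ w : Hn n, (krawtchouk n (hammingNorm w) c / n.choose (hammingNorm w)) •
        fourierMatrix n k w := by
  have hpos : (n.choose c : ℝ) ≠ 0 := by exact_mod_cast (Nat.choose_pos hc).ne'
  have h : (n.choose c : ℝ) • (2 ^ n : ℝ) • pairMatrix n k c =
      ∑ w : Hn n, krawtchouk n c (hammingNorm w) • fourierMatrix n k w := by
    rw [← card_sphere, Nat.cast_smul_eq_nsmul, ← Finset.sum_const]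
    simp_rw [← sum_chr_sphere, Finset.sum_smul]
    rw [Finset.sum_comm]
    refine Finset.sum_congr rfl fun u hu => ?_
    rw [← (Finset.mem_filter.1 hu).2, two_pow_smul_pairMatrix]
    exact Finset.sum_congr rfl fun w _ => by rw [chr_comm]
  rw [← smul_right_inj hpos, h, Finset.smul_sum]
  refine Finset.sum_congr rfl fun w _ => ?_
  have hw := hammingNorm_le_dim w
  have hpos' : (n.choose (hammingNorm w) : ℝ) ≠ 0 := by exact_mod_cast (Nat.choose_pos hw).ne'
  rw [smul_smul, ← mul_div_assoc, ← choose_mul_krawtchouk, mul_div_cancel_left₀ _ hpos']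

lemma posSemidef_sdpMatrix_add {n k : ℕ} {x : ℕ → ℕ → ℕ → ℝ}
    (h : ∀ m ≤ n, 0 ≤ ∑ c ∈ Finset.range (n + 1), x 0 c c * krawtchouk n m c) :
    (sdpMatrix₁ n k x + sdpMatrix₂ n k x).PosSemidef := by
  have h2 : (0 : ℝ) < 2 ^ n := by positivity
  refine posSemidef_of_smul h2 ?_
  have e : (2 ^ n : ℝ) • (sdpMatrix₁ n k x + sdpMatrix₂ n k x) =
      ∑ w : Hn n, ((∑ c ∈ Finset.range (n + 1), x 0 c c * krawtchouk n (hammingNorm w) c) /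
        n.choose (hammingNorm w)) • fourierMatrix n k w := by
    simp_rw [Finset.sum_div, Finset.sum_smul]
    rw [sdpMatrix_add_eq_sum_pairMatrix, Finset.smul_sum, Finset.sum_comm]
    refine Finset.sum_congr rfl fun c hc => ?_
    rw [smul_comm, two_pow_smul_pairMatrix' (Nat.lt_succ_iff.1 (Finset.mem_range.1 hc)),
      Finset.smul_sum]
    exact Finset.sum_congr rfl fun w _ => by rw [smul_smul, mul_div_assoc]
  rw [e]
  exact Matrix.posSemidef_sum _ fun w _ => (posSemidef_fourierMatrix n k w).smul
    (div_nonneg (h _ (hammingNorm_le_dim w)) (Nat.cast_nonneg _))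

/-! ### The converse, from `k = 0` -/

/-- The indicator of the zero word lies in `H_{0,0}`, since the condition on weight `k - 1` is
vacuous; apply the reproducing property to it. -/
lemma harmKernel_zero_zero (n : ℕ) : harmKernel n 0 0 0 = 1 := by
  have hf : EuclideanSpace.single (0 : Hn n) (1 : ℝ) ∈ harm n 0 := by
    refine ⟨fun x hx => ?_, fun z hz => by omega⟩
    have : x ≠ 0 := fun h => hx (by rw [h, hammingNorm_zero])
    simp [this]
  have h := sum_mul_harmKernel n 0 hf 0
  simpa [Pi.single_apply] using h

lemma zonalE_zero (n : ℕ) (x y : Hn n) (i j : Fin (n - 2 * 0 + 1)) :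
    zonalE n 0 x y i j = if hammingNorm x = i ∧ hammingNorm y = j then 2 ^ n else 0 := by
  have h : ∀ x : Hn n, ((Finset.univ : Finset (Hn n)).filter
      fun x' => hammingNorm x' = 0 ∧ Sub x' x) = {0} := fun x => by
    ext x'
    simp only [Finset.mem_filter, Finset.mem_univ, true_and, hammingNorm_eq_zero,
      Finset.mem_singleton, and_iff_left_iff_imp]
    rintro rfl i hi
    exact absurd rfl hi
  rw [zonalE_apply, h, h, Finset.sum_singleton, Finset.sum_singleton, harmKernel_zero_zero,
    mul_one, zero_add, zero_add]

/-- `K_m(wt ·)` is the Fourier transform of the indicator of a sphere, which is idempotent under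
multiplication; hence its self-convolution is `2ⁿ` times itself. -/
lemma sum_krawtchouk_mul_krawtchouk {n m : ℕ} (u : Hn n) :
    ∑ z : Hn n, krawtchouk n m (hammingNorm (u + z)) * krawtchouk n m (hammingNorm z) =
      2 ^ n * krawtchouk n m (hammingNorm u) := by
  have h : ∀ z : Hn n, krawtchouk n m (hammingNorm (u + z)) * krawtchouk n m (hammingNorm z) =
      ∑ w : Hn n with hammingNorm w = m, ∑ w' : Hn n with hammingNorm w' = m,
        chr w u * chr z (w + w') := fun z => by
    rw [← sum_chr_sphere, ← sum_chr_sphere, Finset.sum_mul_sum]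
    refine Finset.sum_congr rfl fun w _ => Finset.sum_congr rfl fun w' _ => ?_
    rw [chr_add, chr_add, chr_comm z w, chr_comm z w', mul_assoc]
  simp only [h]
  rw [Finset.sum_comm, ← sum_chr_sphere, Finset.mul_sum]
  refine Finset.sum_congr rfl fun w hw => ?_
  rw [Finset.sum_comm]
  simp_rw [← Finset.mul_sum, sum_chr, word_add_eq_zero]
  rw [Finset.sum_ite_eq, if_pos hw, mul_comm]

/-- `E_0(u + z, z)` has the single nonzero entry `2ⁿ`, at `(wt(u + z), wt(z))`, so the quadratic
form is `2ⁿ` times the self-convolution of `K_m(wt ·)`, which supplies the other `2ⁿ`. -/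
lemma krawtchouk_quadratic_pairMatrix {n m c : ℕ} (hc : c ≤ n) :
    ∑ i : Fin (n - 2 * 0 + 1), ∑ j : Fin (n - 2 * 0 + 1),
      krawtchouk n m i * pairMatrix n 0 c i j * krawtchouk n m j =
        2 ^ n * 2 ^ n * krawtchouk n m c := by
  obtain ⟨u, rfl⟩ := exists_hammingNorm_eq hc
  rw [mul_assoc, ← sum_krawtchouk_mul_krawtchouk u, pairMatrix_eq_sum, Finset.mul_sum]
  simp only [Matrix.sum_apply, Finset.mul_sum, Finset.sum_mul]
  simp_rw [Finset.sum_comm (s := (Finset.univ : Finset (Fin (n - 2 * 0 + 1))))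
    (t := (Finset.univ : Finset (Hn n)))]
  refine Finset.sum_congr rfl fun z _ => ?_
  have hi : ∀ v : Hn n, hammingNorm v < n - 2 * 0 + 1 := fun v => by
    have := hammingNorm_le_dim v
    omega
  rw [Finset.sum_eq_single ⟨_, hi (u + z)⟩ _ (by simp),
    Finset.sum_eq_single ⟨_, hi z⟩ _ (by simp)]
  · simp only [zonalE_zero, and_self, if_true]
    ring
  · intro j _ hj
    have : hammingNorm z ≠ j := fun h => hj (Fin.ext h.symm)
    simp [zonalE_zero, this]
  · intro i _ hi'
    have : hammingNorm (u + z) ≠ i := fun h => hi' (Fin.ext h.symm)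
    simp [zonalE_zero, this]

lemma krawtchouk_nonneg_of_posSemidef {n : ℕ} {x : ℕ → ℕ → ℕ → ℝ}
    (h : (sdpMatrix₁ n 0 x + sdpMatrix₂ n 0 x).PosSemidef) (m : ℕ) :
    0 ≤ ∑ c ∈ Finset.range (n + 1), x 0 c c * krawtchouk n m c := by
  have h1 := h.dotProduct_mulVec_nonneg (fun i => krawtchouk n m i)
  have e : star (fun i : Fin (n - 2 * 0 + 1) => krawtchouk n m i) ⬝ᵥ
      ((sdpMatrix₁ n 0 x + sdpMatrix₂ n 0 x).mulVec fun i => krawtchouk n m i) =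
      2 ^ n * 2 ^ n * ∑ c ∈ Finset.range (n + 1), x 0 c c * krawtchouk n m c := by
    rw [sdpMatrix_add_eq_sum_pairMatrix, Matrix.sum_mulVec, dotProduct_sum, Finset.mul_sum]
    refine Finset.sum_congr rfl fun c hc => ?_
    rw [Matrix.smul_mulVec, dotProduct_smul, smul_eq_mul, mul_left_comm,
      ← krawtchouk_quadratic_pairMatrix (Nat.lt_succ_iff.1 (Finset.mem_range.1 hc))]
    simp only [dotProduct, Matrix.mulVec, Finset.mul_sum, Pi.star_apply, star_trivial, mul_assoc]
  rw [e] at h1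
  exact nonneg_of_mul_nonneg_right h1 (by positivity)

/-! ### Comparison with the Delsarte bound -/

lemma lpFeasible_of_sdpFeasible {n δ : ℕ} {x : ℕ → ℕ → ℕ → ℝ} (h : SDPFeasible n δ x) :
    LPFeasible n δ fun c => x 0 c c := by
  have hO : ∀ c ≤ n, (0, c, c) ∈ Omega n := fun c hc => by
    rw [mem_Omega]
    omega
  refine ⟨h.c1, fun i hi => h.c2 _ _ _ (hO i hi), fun k _ => ?_, fun i hi h1 h2 => ?_⟩
  · exact krawtchouk_nonneg_of_posSemidef ((h.c5 0 (Nat.zero_le _)).add (h.c6 0 (Nat.zero_le _))) k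
  · exact h.c7 _ _ _ (hO i hi) (Or.inr (Or.inr ⟨h1, h2⟩))

lemma sdpBound_le_lpBound (n δ : ℕ) : sdpBound n δ ≤ lpBound n δ := by
  refine sSup_le ?_
  rintro v ⟨x, hx, rfl⟩
  exact le_sSup ⟨_, lpFeasible_of_sdpFeasible hx, rfl⟩

end BinaryCode

theorem mainTheorem11 (n δ : ℕ) :
    -- the index set `Ω`, the matrices `T_k` and the numbers `t` are what they are meant to be
    (∀ a b c : ℕ, (a, b, c) ∈ BinaryCode.Omega n ↔
      ∃ x y z : BinaryCode.Hn n, BinaryCode.HasDists a b c x y z) ∧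
    (∀ k, k ≤ n / 2 → ∀ x y z : BinaryCode.Hn n,
      BinaryCode.zonalF n k x y z =
        BinaryCode.matT n k (hammingDist y z) (hammingDist x z) (hammingDist x y)) ∧
    (∀ a b c : ℕ, (a, b, c) ∈ BinaryCode.Omega n → ∀ x y : BinaryCode.Hn n,
      hammingDist x y = c →
        (Finset.univ.filter fun z : BinaryCode.Hn n =>
          hammingDist x z = b ∧ hammingDist y z = a).card = BinaryCode.tCount n a b c) ∧
    -- the three-point distribution of a code satisfies (1)-(7), and its size is the objective
    (∀ C : Finset (BinaryCode.Hn n), C.Nonempty → BinaryCode.MinDistGE δ C →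
      BinaryCode.SDPFeasible n δ (BinaryCode.tripleDist C) ∧
      (C.card : ℝ) = BinaryCode.sdpObjective n (BinaryCode.tripleDist C)) ∧
    -- for a code, the matrices in (5) and (6) are the two sums of the matrices `F_k`
    (∀ C : Finset (BinaryCode.Hn n), C.Nonempty → ∀ k, k ≤ n / 2 →
      (C.card : ℝ) • BinaryCode.sdpMatrix₁ n k (BinaryCode.tripleDist C) =
        ∑ x ∈ C, ∑ y ∈ C, ∑ z ∈ C, BinaryCode.zonalF n k x y z ∧
      (C.card : ℝ) • BinaryCode.sdpMatrix₂ n k (BinaryCode.tripleDist C) =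
        ∑ x ∈ C, ∑ y ∈ C, ∑ z ∈ Cᶜ, BinaryCode.zonalF n k x y z) ∧
    -- the semidefinite program bounds the size of codes
    (∀ C : Finset (BinaryCode.Hn n), BinaryCode.MinDistGE δ C →
      ((C.card : ℝ) : EReal) ≤ BinaryCode.sdpBound n δ) ∧
    -- the sum of the two semidefinite conditions, in terms of `∑_z E_k(x - z, y - z)`
    (∀ k, k ≤ n / 2 → ∀ x y : BinaryCode.Hn n,
      ∑ z : BinaryCode.Hn n, BinaryCode.zonalE n k (x - z) (y - z) =
        ∑ p ∈ (BinaryCode.Omega n).filter (fun p => p.2.2 = hammingDist x y),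
          (BinaryCode.tCount n p.1 p.2.1 p.2.2 : ℝ) • BinaryCode.matT n k p.1 p.2.1 p.2.2) ∧
    (∀ x : ℕ → ℕ → ℕ → ℝ, ∀ k, k ≤ n / 2 →
      BinaryCode.sdpMatrix₁ n k x + BinaryCode.sdpMatrix₂ n k x =
        ∑ p ∈ BinaryCode.Omega n, ((BinaryCode.tCount n p.1 p.2.1 p.2.2 : ℝ) * x 0 p.2.2 p.2.2) •
          BinaryCode.matT n k p.1 p.2.1 p.2.2) ∧
    -- the sum of the two semidefinite conditions is equivalent to the Krawtchouk conditions
    (∀ x : ℕ → ℕ → ℕ → ℝ,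
      (∀ k, k ≤ n / 2 →
        (BinaryCode.sdpMatrix₁ n k x + BinaryCode.sdpMatrix₂ n k x).PosSemidef) ↔
      ∀ k, k ≤ n →
        0 ≤ ∑ c ∈ Finset.range (n + 1), x 0 c c * BinaryCode.krawtchouk n k c) ∧
    -- the semidefinite program contains the linear program, hence its bound is at least as good
    (∀ x : ℕ → ℕ → ℕ → ℝ, BinaryCode.SDPFeasible n δ x →
      BinaryCode.LPFeasible n δ (fun c => x 0 c c)) ∧
    BinaryCode.sdpBound n δ ≤ BinaryCode.lpBound n δ := by
  open BinaryCode in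
  refine ⟨fun a b c => mem_Omega_iff_exists, fun k _ x y z => zonalF_eq_matT n k x y z,
    fun a b c h x y hxy => card_dists h x y hxy,
    fun C hC hδ => ⟨sdpFeasible_tripleDist hC hδ, sdpObjective_tripleDist hC⟩,
    fun C hC k _ => ⟨card_smul_sdpMatrix₁ k hC, card_smul_sdpMatrix₂ k hC⟩,
    fun C hδ => card_le_sdpBound hδ, fun k _ x y => sum_zonalE_eq n k x y,
    fun x k _ => sdpMatrix_add n k x,
    fun x => ⟨fun h k _ => krawtchouk_nonneg_of_posSemidef (h 0 (Nat.zero_le _)) k,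
      fun h k _ => posSemidef_sdpMatrix_add h⟩,
    fun x hx => lpFeasible_of_sdpFeasible hx, sdpBound_le_lpBound n δ⟩
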